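/- Manifolds are finite-dimensional, smooth, Hausdorff, second countable and without boundary. Let $P$ be a manifold, let $\Lambda$ be a finite abelian group (with the discrete topology), and let $C^\infty(P)$ be the unital algebra of smooth functions $P\to\mathbb{C}$ with the smooth compact open topology. A *dynamical system* $(A,\Lambda,\alpha)$ consists of a unital locally convex complex algebra $A$ and a group homomorphism $\alpha:\Lambda\to\mathrm{Aut}(A)$ that induces a continuous action $\Lambda\times A\to A$. For a character $\chi:\Lambda\to\mathbb{T}$ put $A_\chi=\{a\in A:\alpha(\lambda)a=\chi(\lambda)a\text{ for all }\lambda\in\Lambda\}$. The dynamical system is a *trivial noncommutative principal $\Lambda$-bundle* if there is a generating set $\{\lambda_1,\dots,\lambda_k\}$ of $\Lambda$ of minimal cardinality, with $n_i$ the order of $\lambda_i$, such that for each $i$ there is a character $\widehat\lambda_i$ of $\Lambda$ with $\widehat\lambda_i(\lambda_i)=\exp(2\pi\sqrt{-1}/n_i)$ and $\widehat\lambda_i(\lambda_j)=1$ for $j\neq i$, and $A_{\widehat\lambda_i}$ contains an invertible element $a_i$ with $a_i^{n_i}=1_A$. A *principal $\Lambda$-bundle* $(P,M,\Lambda,q,\sigma)$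 consists of manifolds $P,M$, a smooth map $q:P\to M$ and a smooth right action $\sigma:P\times\Lambda\to P$ preserving the fibres of $q$, such that each point of $M$ has an open neighbourhood $U$ with a $\Lambda$-equivariant diffeomorphism $q^{-1}(U)\to U\times\Lambda$ over $U$. It is *trivial* if there is a $\Lambda$-equivariant diffeomorphism $P\to M\times\Lambda$ over $M$. **Theorem.** (a) Let $(C^\infty(P),\Lambda,\alpha)$ be a trivial noncommutative principal $\Lambda$-bundle. Then there is a unique map $\sigma:P\times\Lambda\to P$ with $\delta_{\sigma(p,\lambda)}=\delta_p\circ\alpha(\lambda)$ for all $p\in P$, $\lambda\in\Lambda$, where $\delta_p:C^\infty(P)\to\mathbb{C}$ is evaluation at $p$. The orbit space $P/\Lambda$ of $\sigma$, with the quotient topology, is Hausdorff and second countable and carries a smooth manifold structure for which $(P,P/\Lambda,\Lambda,\mathrm{pr},\sigma)$, with $\mathrm{pr}$ the orbit map, is a principal $\Lambda$-bundle; and for any such structure this principal bundle is trivial. (b) Conversely, let $(P,M,\Lambda,q,\sigma)$ be a trivial principal $\Lambda$-bundle. Then $(\alpha(\lambda)f)(p):=f(\sigma(p,\lambda))$ defines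 a dynamical system $(C^\infty(P),\Lambda,\alpha)$, and it is a trivial noncommutative principal $\Lambda$-bundle. -/

import Mathlib

open scoped Manifold ContDiff

attribute [local instance] ChartedSpace.ofDiscreteTopology

section DynamicalSystems

/-- A dynamical system `(A, G, α)`: a homomorphism `α` from the topological group `G` to the
automorphisms of the unital complex (locally convex) algebra `A` such that the induced action
`G × A → A` is continuous.  In particular each `α g` is a homeomorphism of `A`. -/
structure DynamicalSystem (A G : Type*) [Ring A] [Algebra ℂ A] [TopologicalSpace A]
    [Group G] [TopologicalSpace G] where
  /-- the homomorphism `α : G → Aut(A)` -/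
  toHom : G →* (A ≃ₐ[ℂ] A)
  continuous_action : Continuous fun x : G × A => toHom x.1 x.2

/-- The isotypic component `A_χ = {a : α(g) a = χ(g) · a for all g}` of a character `χ`. -/
def DynamicalSystem.isotypic {A G : Type*} [Ring A] [Algebra ℂ A] [TopologicalSpace A]
    [Group G] [TopologicalSpace G] (α : DynamicalSystem A G) (χ : G →* Circle) : Set A :=
  {a | ∀ g : G, α.toHom g a = (χ g : ℂ) • a}

/-- `χ` is the character dual to the element `s` of the generating set `S`: it takes the value
`exp (2πi / n)`, `n` the order of `s`, at `s`, and the value `1` at the other elements of `S`. -/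
def IsDualCharacter {G : Type*} [Group G] (S : Finset G) (s : G) (χ : G →* Circle) : Prop :=
  (χ s : ℂ) = Complex.exp (2 * Real.pi * Complex.I / (orderOf s : ℂ)) ∧
    ∀ t ∈ S, t ≠ s → χ t = 1

/-- A dynamical system with finite group `G` is a trivial noncommutative principal `G`-bundle if
there is a set `S` of generators of `G` of minimal cardinality such that every `s ∈ S` has a dual
character whose isotypic component contains an invertible `a` with `a ^ n = 1`, where `n` is the
order of `s`. -/
def DynamicalSystem.IsTrivialNCPBundle {A G : Type*} [Ring A] [Algebra ℂ A] [TopologicalSpace A]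
    [CommGroup G] [Finite G] [TopologicalSpace G] (α : DynamicalSystem A G) : Prop :=
  ∃ S : Finset G, Subgroup.closure (S : Set G) = ⊤ ∧ S.card = Group.rank G ∧
    ∀ s ∈ S, ∃ χ : G →* Circle, IsDualCharacter S s χ ∧
      ∃ a ∈ α.isotypic χ, IsUnit a ∧ a ^ orderOf s = 1

end DynamicalSystems

noncomputable section SmoothFunctions

/-- `ℂ`, as a real manifold, is a smooth ring. -/
instance contMDiffRing_complex_real : ContMDiffRing 𝓘(ℝ, ℂ) ∞ ℂ where
  contMDiff_add := contMDiff_add 𝓘(ℝ, ℂ) ∞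
  contMDiff_mul := by
    rw [← modelWithCornersSelf_prod, chartedSpaceSelf_prod]
    exact contDiff_mul.contMDiff

variable (E : Type*) [NormedAddCommGroup E] [NormedSpace ℝ E]
  (P : Type*) [TopologicalSpace P] [ChartedSpace E P]

/-- The algebra `C^∞(P)` of smooth complex valued functions on `P`. -/
abbrev SmoothFun : Type _ := C^∞⟮𝓘(ℝ, E), P; 𝓘(ℝ, ℂ), ℂ⟯

/-- The inclusion of the constant functions into `C^∞(P)`. -/
def SmoothFun.const : ℂ →+* SmoothFun E P where
  toFun c := ⟨fun _ => c, contMDiff_const⟩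
  map_one' := rfl
  map_zero' := rfl
  map_mul' _ _ := rfl
  map_add' _ _ := rfl

/-- `C^∞(P)` as a complex algebra, with pointwise operations. -/
instance SmoothFun.algebraComplex : Algebra ℂ (SmoothFun E P) :=
  (SmoothFun.const E P).toAlgebra

/-- The smooth compact open topology on `C^∞(P)`: in every smooth chart `φ` of `P`, uniform
convergence of the derivatives of each order on the compact subsets of the range of `φ`. -/
instance SmoothFun.topology : TopologicalSpace (SmoothFun E P) :=
  ⨅ φ ∈ IsManifold.maximalAtlas 𝓘(ℝ, E) ∞ P, ⨅ k : ℕ,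
    TopologicalSpace.induced
      (fun f : SmoothFun E P =>
        UniformOnFun.ofFun {K : Set E | IsCompact K ∧ K ⊆ φ.target}
          (iteratedFDeriv ℝ k (fun x => f (φ.symm x))))
      inferInstance

variable {E P} in
/-- The point evaluation `δ_p : C^∞(P) → ℂ`. -/
def SmoothFun.eval (p : P) : SmoothFun E P →ₐ[ℂ] ℂ where
  toFun f := f p
  map_one' := rfl
  map_mul' _ _ := rfl
  map_zero' := rfl
  map_add' _ _ := rfl
  commutes' _ := rfl

variable {E P} in
/-- `σ : P × G → P` is the map induced by the dynamical system `(C^∞(P), G, α)`, that is,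
`(δ_p, g) ↦ δ_p ∘ α(g)` when `P` is identified with the set of characters of `C^∞(P)`. -/
def DynamicalSystem.Induces {G : Type*} [Group G] [TopologicalSpace G]
    (α : DynamicalSystem (SmoothFun E P) G) (σ : P → G → P) : Prop :=
  ∀ (p : P) (g : G),
    SmoothFun.eval (E := E) (σ p g) = (SmoothFun.eval p).comp (α.toHom g).toAlgHom

end SmoothFunctions

section PrincipalBundles

/-- The orbit space `P/G` of a right action `σ`, with the quotient topology. -/
abbrev OrbitSpace {P G : Type*} (σ : P → G → P) : Type _ :=
  Quot fun p p' : P => ∃ g : G, σ p g = p'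

variable (E F : Type*) [NormedAddCommGroup E] [NormedSpace ℝ E]
  [NormedAddCommGroup F] [NormedSpace ℝ F]
  {P M G : Type*} [TopologicalSpace P] [ChartedSpace E P] [TopologicalSpace M] [ChartedSpace F M]
  [Group G] [TopologicalSpace G] [DiscreteTopology G]

/-- `(P, M, G, q, σ)` is a smooth principal bundle with discrete structure group `G`, where `P` and
`M` are manifolds modelled on `E` and `F`: `q : P → M` is smooth, `σ` is a smooth right action of
`G` on `P` preserving the fibres of `q`, and every point of `M` has an open neighbourhood `U` with a
`G`-equivariant diffeomorphism `q ⁻¹(U) → U × G` over `U`. -/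
structure IsPrincipalBundle (q : P → M) (σ : P → G → P) : Prop where
  smooth_proj : ContMDiff 𝓘(ℝ, E) 𝓘(ℝ, F) ∞ q
  smooth_act : ContMDiff (𝓘(ℝ, E).prod (𝓡 0)) 𝓘(ℝ, E) ∞ (fun x : P × G => σ x.1 x.2)
  act_one : ∀ p, σ p 1 = p
  act_mul : ∀ p g h, σ p (g * h) = σ (σ p g) h
  proj_act : ∀ p g, q (σ p g) = q p
  locally_trivial : ∀ x : M, ∃ U : Set M, IsOpen U ∧ x ∈ U ∧
    ∃ ψ : PartialDiffeomorph 𝓘(ℝ, E) (𝓘(ℝ, F).prod (𝓡 0)) P (M × G) ∞,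
      ψ.source = q ⁻¹' U ∧ ψ.target = U ×ˢ Set.univ ∧
      (∀ p ∈ q ⁻¹' U, (ψ p).1 = q p) ∧
      ∀ p ∈ q ⁻¹' U, ∀ g, ψ (σ p g) = ((ψ p).1, (ψ p).2 * g)

/-- A principal bundle is trivial if it is equivalent, over `M`, to the bundle `M × G → M`: there
is a `G`-equivariant diffeomorphism `P → M × G` over `M`. -/
structure IsTrivialPrincipalBundle (q : P → M) (σ : P → G → P) : Prop
    extends IsPrincipalBundle E F q σ where
  trivial : ∃ φ : Diffeomorph 𝓘(ℝ, E) (𝓘(ℝ, F).prod (𝓡 0)) P (M × G) ∞,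
    (∀ p, (φ p).1 = q p) ∧ ∀ p g, φ (σ p g) = ((φ p).1, (φ p).2 * g)

end PrincipalBundles

/-! ### Dual characters and generating sets of finite abelian groups. -/

section DualCharacters

/-! The characters `χ s` dual to a generating set `S` identify the group with a product of groups of
roots of unity, one of order `orderOf s` for each `s ∈ S` (`eq_of_dualCharacters_eq`,
`exists_dualCharacters_eq`).

For (a), the action exists because every unital algebra homomorphism from `C^∞(P)` to `ℂ` is a point
evaluation (`SmoothFun.exists_eq_eval`). The values of the invertible elements `a s` are roots of
unity of the right orders, so together they define a map `θ : P → G`. It is continuous, hence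
locally constant, and `a s` lying in the isotypic component of `χ s` makes `θ` equivariant.
Therefore `θ ⁻¹' {1}` is an open set meeting every orbit exactly once: the orbit space is this open
submanifold of `P`, and `p ↦ ([p], θ p)` is a global trivialization.

For (b), the second component `θ` of a trivialization gives the elements `a s = χ s ∘ θ`. What
remains is a generating set of minimal cardinality with dual characters, which comes from the Smith
normal form (`exists_generators_dualCharacter`), and the continuity of pullback on `C^∞(P)`. -/

theorem IsDualCharacter.isPrimitiveRoot {G : Type*} [Group G] [Finite G] {S : Finset G} {s : G}
    {χ : G →* Circle} (h : IsDualCharacter S s χ) : IsPrimitiveRoot (χ s : ℂ) (orderOf s) := by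
  rw [h.1]
  exact Complex.isPrimitiveRoot_exp _ (orderOf_pos s).ne'

theorem IsDualCharacter.apply_prod_pow {G : Type*} [CommGroup G] {S : Finset G} {s : G}
    {χ : G →* Circle} (h : IsDualCharacter S s χ) (hs : s ∈ S) (m : G → ℕ) :
    χ (∏ t ∈ S, t ^ m t) = χ s ^ m s := by
  rw [map_prod, Finset.prod_eq_single_of_mem s hs fun t ht hts => by simp [h.2 t ht hts], map_pow]

/-- Natural exponents suffice because inverses in a finite group are positive powers. -/
theorem exists_eq_prod_pow_of_closure_eq_top {G : Type*} [CommGroup G] [Finite G] {S : Finset G}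
    (hS : Subgroup.closure (S : Set G) = ⊤) (g : G) : ∃ m : G → ℕ, g = ∏ s ∈ S, s ^ m s := by
  have hmem : g ∈ Submonoid.closure (S : Set G) := by
    rw [← Subgroup.closure_toSubmonoid_of_finite, hS]
    trivial
  obtain ⟨m, -, rfl⟩ := Submonoid.mem_closure_finset.1 hmem
  exact ⟨m, rfl⟩

theorem IsDualCharacter.exists_apply_eq_pow {G : Type*} [CommGroup G] [Finite G] {S : Finset G}
    {s : G} {χ : G →* Circle} (h : IsDualCharacter S s χ)
    (hS : Subgroup.closure (S : Set G) = ⊤) (hs : s ∈ S) (g : G) : ∃ m : ℕ, χ g = χ s ^ m := by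
  obtain ⟨m, rfl⟩ := exists_eq_prod_pow_of_closure_eq_top hS g
  exact ⟨m s, h.apply_prod_pow hs m⟩

/-- A family of characters dual to a generating set separates the points of a finite group. -/
theorem eq_of_dualCharacters_eq {G : Type*} [CommGroup G] [Finite G] {S : Finset G}
    (hS : Subgroup.closure (S : Set G) = ⊤) {χ : G → G →* Circle}
    (hχ : ∀ s ∈ S, IsDualCharacter S s (χ s)) {g h : G} (hgh : ∀ s ∈ S, χ s g = χ s h) :
    g = h := by
  suffices H : ∀ g : G, (∀ s ∈ S, χ s g = 1) → g = 1 by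
    rw [← div_eq_one]
    exact H _ fun s hs => by rw [map_div, hgh s hs, div_self']
  intro g hg
  obtain ⟨m, rfl⟩ := exists_eq_prod_pow_of_closure_eq_top hS g
  refine Finset.prod_eq_one fun s hs => ?_
  have h1 := hg s hs
  rw [(hχ s hs).apply_prod_pow hs] at h1
  -- The value `χ s s` is a root of unity of exact order `orderOf s`, so `χ s s ^ m s = 1` already
  -- forces `s ^ m s = 1`.
  apply orderOf_dvd_iff_pow_eq_one.1
  apply (hχ s hs).isPrimitiveRoot.dvd_of_pow_eq_one
  simpa using congrArg (fun z : Circle => (z : ℂ)) h1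

/-- Any family of roots of unity of the right orders is the family of values, at some group
element, of a given family of dual characters. -/
theorem exists_dualCharacters_eq {G : Type*} [CommGroup G] [Finite G] {S : Finset G}
    {χ : G → G →* Circle} (hχ : ∀ s ∈ S, IsDualCharacter S s (χ s)) {z : G → ℂ}
    (hz : ∀ s ∈ S, z s ^ orderOf s = 1) : ∃ g : G, ∀ s ∈ S, (χ s g : ℂ) = z s := by
  have H : ∀ s : G, ∃ m : ℕ, s ∈ S → (χ s s : ℂ) ^ m = z s := fun s => by
    by_cases hs : s ∈ S
    · have : NeZero (orderOf s) := ⟨(orderOf_pos s).ne'⟩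
      obtain ⟨m, -, hm⟩ := (hχ s hs).isPrimitiveRoot.eq_pow_of_pow_eq_one (hz s hs)
      exact ⟨m, fun _ => hm⟩
    · exact ⟨0, fun h => absurd h hs⟩
  choose m hm using H
  refine ⟨∏ t ∈ S, t ^ m t, fun s hs => ?_⟩
  rw [(hχ s hs).apply_prod_pow hs, Circle.coe_pow, hm s hs]

/-- A finite abelian group is a product of as many cyclic groups as it needs generators. -/
theorem exists_addEquiv_pi_zmod_rank (G : Type*) [CommGroup G] [Finite G] :
    ∃ n : Fin (Group.rank G) → ℕ, (∀ i, n i ≠ 0) ∧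
      Nonempty (Additive G ≃+ ((i : Fin (Group.rank G)) → ZMod (n i))) := by
  obtain ⟨S, hcard, hS⟩ := Group.rank_spec G
  let v : Fin (Group.rank G) → Additive G :=
    fun i => Additive.ofMul ((S.equivFinOfCardEq hcard).symm i : G)
  -- A minimal generating set presents the group as a quotient of a free abelian group of rank
  -- `Group.rank G`. The quotient is finite, so the kernel has full rank, and its Smith normal form
  -- provides exactly that many nonzero moduli.
  let f : (Fin (Group.rank G) → ℤ) →ₗ[ℤ] Additive G := Fintype.linearCombination ℤ v
  have hf : Function.Surjective f := by
    rw [← LinearMap.range_eq_top, Fintype.range_linearCombination]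
    have hr : Set.range v = Additive.toMul ⁻¹' (S : Set G) := by
      ext x
      constructor
      · rintro ⟨i, rfl⟩
        exact ((S.equivFinOfCardEq hcard).symm i).2
      · intro hx
        exact ⟨S.equivFinOfCardEq hcard ⟨_, hx⟩, by simp only [v, Equiv.symm_apply_apply]; rfl⟩
    apply Submodule.toAddSubgroup_injective
    rw [Submodule.span_int_eq_addSubgroupClosure, hr, ← Subgroup.toAddSubgroup_closure, hS]
    rfl
  have e := (LinearMap.quotKerEquivOfSurjective f hf).toAddEquiv
  have : Finite ((Fin (Group.rank G) → ℤ) ⧸ LinearMap.ker f) := Finite.of_equiv _ e.symm.toEquiv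
  have hr := (LinearMap.ker f).finiteQuotient_iff.1 this
  refine ⟨_, fun i => ?_, ⟨e.symm.trans
    ((LinearMap.ker f).quotientEquivPiZMod (Pi.basisFun ℤ (Fin (Group.rank G))) hr)⟩⟩
  exact Int.natAbs_ne_zero.2 (Submodule.smithNormalFormCoeffs_ne_zero _ hr i)

/-- A finite abelian group has a generating set of minimal cardinality all of whose elements have
dual characters. -/
theorem exists_generators_dualCharacter (G : Type*) [CommGroup G] [Finite G] :
    ∃ S : Finset G, Subgroup.closure (S : Set G) = ⊤ ∧ S.card = Group.rank G ∧
      ∀ s ∈ S, ∃ χ : G →* Circle, IsDualCharacter S s χ := by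
  classical
  obtain ⟨n, hn, ⟨e⟩⟩ := exists_addEquiv_pi_zmod_rank G
  have (i : Fin (Group.rank G)) : NeZero (n i) := ⟨hn i⟩
  let v : Fin (Group.rank G) → G := fun i => (e.symm (Pi.single i 1)).toMul
  have hS : Subgroup.closure ((Finset.univ.image v : Finset G) : Set G) = ⊤ := by
    rw [eq_top_iff]
    intro g _
    have hg : g = ∏ i, v i ^ (e (Additive.ofMul g) i).val := by
      apply Additive.ofMul.injective
      apply e.injective
      rw [ofMul_prod, map_sum]
      simp_rw [ofMul_pow, map_nsmul]
      simp only [v, ofMul_toMul, AddEquiv.apply_symm_apply, ← Pi.single_smul, nsmul_eq_mul,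
        ZMod.natCast_val, ZMod.cast_id', id, mul_one]
      exact (Finset.univ_sum_single _).symm
    rw [hg]
    exact Subgroup.prod_mem _ fun i _ => Subgroup.pow_mem _
      (Subgroup.subset_closure (by simp)) _
  -- The image of `v` has at most `Group.rank G` elements and generates, so it has exactly that
  -- many.
  refine ⟨_, hS, le_antisymm (by simpa using Finset.card_image_le (s := Finset.univ) (f := v))
    (Group.rank_le hS), fun s hs => ?_⟩
  obtain ⟨i, -, rfl⟩ := Finset.mem_image.1 hs
  have ho : orderOf (v i) = n i := by
    rw [← addOrderOf_ofMul_eq_orderOf]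
    simp only [v, ofMul_toMul]
    rw [AddEquiv.addOrderOf_eq]
    exact (addOrderOf_injective (AddMonoidHom.single (fun i => ZMod (n i)) i)
      (fun _ _ h => Pi.single_injective i h) 1).trans (ZMod.addOrderOf_one (n i))
  -- The dual character of `v i` is the `i`-th coordinate followed by the standard character of
  -- `ZMod (n i)`.
  refine ⟨⟨⟨fun g => ZMod.toCircle (e (Additive.ofMul g) i), by simp⟩, fun g h => by
    simp [AddChar.map_add_eq_mul]⟩, ?_, ?_⟩
  · have := ZMod.toCircle_intCast (N := n i) 1
    simp only [Int.cast_one, mul_one] at this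
    simp [v, ho, this]
  · intro t ht hti
    obtain ⟨j, -, rfl⟩ := Finset.mem_image.1 ht
    have hij : i ≠ j := fun h => hti (by rw [h])
    simp [v, hij]

end DualCharacters

/-! ### Characters of `C^∞(P)` and smoothness tested by functions. -/

section SmoothFunctions

open Topology

variable {E : Type*} [NormedAddCommGroup E] [NormedSpace ℝ E]
  {P : Type*} [TopologicalSpace P] [ChartedSpace E P]

theorem SmoothFun.smul_apply (c : ℂ) (f : SmoothFun E P) (p : P) : (c • f) p = c * f p := rfl

theorem SmoothFun.eval_apply (p : P) (f : SmoothFun E P) : SmoothFun.eval p f = f p := rfl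

/-- The complex valued smooth function with the given real values. -/
noncomputable def SmoothFun.ofReal (f : P → ℝ) (hf : ContMDiff 𝓘(ℝ, E) 𝓘(ℝ, ℝ) ∞ f) :
    SmoothFun E P :=
  ⟨fun p => (f p : ℂ), Complex.ofRealCLM.contDiff.contMDiff.comp hf⟩

theorem SmoothFun.ofReal_apply (f : P → ℝ) (hf : ContMDiff 𝓘(ℝ, E) 𝓘(ℝ, ℝ) ∞ f) (p : P) :
    SmoothFun.ofReal f hf p = (f p : ℂ) := rfl

/-- The complex conjugate of a smooth function. -/
noncomputable def SmoothFun.conj (f : SmoothFun E P) : SmoothFun E P :=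
  ⟨fun p => starRingEnd ℂ (f p), Complex.conjCLE.contDiff.contMDiff.comp f.contMDiff⟩

theorem SmoothFun.isUnit_of_forall_ne_zero {f : SmoothFun E P} (hf : ∀ p, f p ≠ 0) :
    IsUnit f := by
  refine IsUnit.of_mul_eq_one ⟨fun p => (f p)⁻¹, fun p => ?_⟩ ?_
  · exact (contDiffAt_inv ℝ (hf p)).contMDiffAt.comp p f.contMDiff.contMDiffAt
  · ext p
    exact mul_inv_cancel₀ (hf p)

theorem SmoothFun.conj_mul_self_apply (f : SmoothFun E P) (p : P) :
    (f.conj * f) p = (Complex.normSq (f p) : ℂ) :=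
  (Complex.normSq_eq_conj_mul_self).symm

/-- Finitely many smooth functions in the kernel of a unital algebra homomorphism to `ℂ` have a
common zero. -/
theorem SmoothFun.exists_common_zero (φ : SmoothFun E P →ₐ[ℂ] ℂ) {ι : Type*} (t : Finset ι)
    (f : ι → SmoothFun E P) (hf : ∀ i ∈ t, φ (f i) = 0) : ∃ p, ∀ i ∈ t, f i p = 0 := by
  by_contra! h
  -- Without a common zero, the sum of the `|f i|²` vanishes nowhere and is invertible. It
  -- nevertheless lies in the kernel of `φ`, being a combination of the `f i`; no compatibility of
  -- `φ` with conjugation is needed.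
  have hu : IsUnit (∑ i ∈ t, (f i).conj * f i) := by
    apply SmoothFun.isUnit_of_forall_ne_zero
    intro p hp
    obtain ⟨i, hi, hip⟩ := h p
    rw [← SmoothFun.eval_apply, map_sum] at hp
    simp_rw [SmoothFun.eval_apply, SmoothFun.conj_mul_self_apply] at hp
    norm_cast at hp
    rw [Finset.sum_eq_zero_iff_of_nonneg fun i _ => Complex.normSq_nonneg _] at hp
    exact hip (Complex.normSq_eq_zero.1 (hp i hi))
  apply (hu.map φ).ne_zero
  rw [map_sum]
  exact Finset.sum_eq_zero fun i hi => by rw [map_mul, hf i hi, mul_zero]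

variable [FiniteDimensional ℝ E] [T2Space P] [IsManifold 𝓘(ℝ, E) ∞ P]

theorem exists_smoothFun_apply_ne_zero {p : P} {U : Set P} (hU : U ∈ 𝓝 p) :
    ∃ f : SmoothFun E P, f p ≠ 0 ∧ ∀ x, f x ≠ 0 → x ∈ U := by
  obtain ⟨b, -, hb⟩ := (SmoothBumpFunction.nhds_basis_support (I := 𝓘(ℝ, E)) hU).mem_iff.1 hU
  refine ⟨SmoothFun.ofReal b b.contMDiff, ?_, fun x hx => hb ?_⟩
  · simp [SmoothFun.ofReal_apply]
  · simpa [SmoothFun.ofReal_apply] using hx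

theorem SmoothFun.eval_injective : Function.Injective (SmoothFun.eval (E := E) (P := P)) := by
  intro p p' h
  by_contra hne
  obtain ⟨f, hf, hfU⟩ := exists_smoothFun_apply_ne_zero (E := E)
    (isOpen_compl_singleton.mem_nhds (show p ∈ {p'}ᶜ from hne))
  refine hfU p' ?_ rfl
  rwa [← SmoothFun.eval_apply, ← h]

variable (E P) in
-- Makes up for the possible noncompactness of `P`: a partition of unity gives a smooth `f` that
-- dominates the index `K.find` of a compact exhaustion, so the level set at `c` is closed in the
-- compact set `K ⌈c⌉₊`.
theorem exists_smooth_isCompact_level [SecondCountableTopology P] :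
    ∃ f : P → ℝ, ContMDiff 𝓘(ℝ, E) 𝓘(ℝ, ℝ) ∞ f ∧ ∀ c, IsCompact {p | f p = c} := by
  have := Manifold.locallyCompact_of_finiteDimensional (M := P) 𝓘(ℝ, E)
  let K := CompactExhaustion.choice P
  obtain ⟨f, hf⟩ := exists_contMDiffMap_forall_mem_convex_of_local_const (n := ⊤) 𝓘(ℝ, E)
    (M := P) (t := fun p => Set.Ici (K.find p : ℝ)) (fun p => convex_Ici _) fun p => by
      obtain ⟨n, hn⟩ := K.exists_mem_nhds p
      refine ⟨n, Filter.mem_of_superset hn fun x hx => ?_⟩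
      change (K.find x : ℝ) ≤ n
      exact_mod_cast K.mem_iff_find_le.1 hx
  refine ⟨f, f.contMDiff, fun c => ?_⟩
  refine (K.isCompact ⌈c⌉₊).of_isClosed_subset
    (isClosed_eq f.contMDiff.continuous continuous_const) fun p hp => ?_
  rw [K.mem_iff_find_le]
  have h1 : (K.find p : ℝ) ≤ f p := hf p
  have h2 : f p = c := hp
  exact_mod_cast (h1.trans h2.le).trans (Nat.le_ceil c)

/-- Every unital algebra homomorphism `C^∞(P) → ℂ` is a point evaluation. -/
theorem SmoothFun.exists_eq_eval [SecondCountableTopology P] (φ : SmoothFun E P →ₐ[ℂ] ℂ) :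
    ∃ p, φ = SmoothFun.eval p := by
  classical
  by_contra! h
  have H : ∀ p : P, ∃ f : SmoothFun E P, φ f = 0 ∧ f p ≠ 0 := fun p => by
    obtain ⟨f, hf⟩ := DFunLike.ne_iff.1 (h p)
    refine ⟨f - algebraMap ℂ _ (φ f), by rw [map_sub, AlgHom.commutes]; exact sub_self _, ?_⟩
    intro h0
    exact hf (sub_eq_zero.1 h0).symm
  choose f hf hfp using H
  obtain ⟨ρ, hρ, hK⟩ := exists_smooth_isCompact_level E P
  -- The zeros of `r` lie in one compact level set of `ρ`, which finitely many of the sets `f p ≠ 0`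
  -- cover. Then `r` and these `f p` lie in the kernel of `φ` but have no common zero. Taking the
  -- real part is harmless: at a zero of `r` the number `φ ρ` is real.
  let r : SmoothFun E P := SmoothFun.ofReal ρ hρ - algebraMap ℂ _ (φ (SmoothFun.ofReal ρ hρ))
  obtain ⟨t, -, ht⟩ := (hK (φ (SmoothFun.ofReal ρ hρ)).re).elim_nhds_subcover
    (fun p => {x | f p x ≠ 0}) fun p _ =>
      (f p).contMDiff.continuous.continuousAt.eventually_ne (hfp p)
  obtain ⟨p, hp⟩ := SmoothFun.exists_common_zero φ (Finset.insertNone t) (fun i => i.elim r f) (by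
    rintro (_ | p) _
    · change φ r = 0
      rw [map_sub, AlgHom.commutes]
      exact sub_self _
    · exact hf p)
  have hpr : (ρ p : ℂ) = φ (SmoothFun.ofReal ρ hρ) := sub_eq_zero.1 (hp none (by simp))
  have hpK : p ∈ {p | ρ p = (φ (SmoothFun.ofReal ρ hρ)).re} := by
    simp [← hpr]
  obtain ⟨i, hi, hip⟩ := Set.mem_iUnion₂.1 (ht hpK)
  exact hip (hp (some i) (by simpa using hi))

/-- A map into a manifold is smooth if its composition with every smooth function is smooth. -/
theorem contMDiff_of_forall_smoothFun {E' H' : Type*} [NormedAddCommGroup E'] [NormedSpace ℝ E']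
    [TopologicalSpace H'] {I' : ModelWithCorners ℝ E' H'} {X : Type*} [TopologicalSpace X]
    [ChartedSpace H' X] {F : X → P}
    (hF : ∀ f : SmoothFun E P, ContMDiff I' 𝓘(ℝ, ℂ) ∞ fun x => f (F x)) :
    ContMDiff I' 𝓘(ℝ, E) ∞ F := by
  have hc : Continuous F := by
    rw [continuous_iff_continuousAt]
    intro x U hU
    obtain ⟨f, hf, hfU⟩ := exists_smoothFun_apply_ne_zero (E := E) hU
    exact Filter.mem_of_superset
      ((hF f).continuous.continuousAt.eventually_ne hf) fun y hy => hfU _ hy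
  intro x
  rw [contMDiffAt_iff_target]
  refine ⟨hc.continuousAt, ?_⟩
  have b : SmoothBumpFunction 𝓘(ℝ, E) (F x) := Classical.choice inferInstance
  -- The chart at `F x`, cut off by a bump function so as to be smooth on all of `P`; it agrees with
  -- the chart near `F x`.
  let u : P → E := fun p => b p • extChartAt 𝓘(ℝ, E) (F x) p
  have hu : ContMDiff 𝓘(ℝ, E) 𝓘(ℝ, E) ∞ u :=
    b.contMDiff_smul (contMDiffOn_extChartAt.congr fun _ _ => rfl)
  have huF : ContMDiff I' 𝓘(ℝ, E) ∞ (u ∘ F) := by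
    -- Linear coordinates on `E` reduce the claim to real valued functions. These are tested by
    -- viewing them as complex valued and taking the real part.
    let L := ContinuousLinearEquiv.ofFinrankEq
      (show Module.finrank ℝ E = Module.finrank ℝ (Fin (Module.finrank ℝ E) → ℝ) by simp)
    have hL : ContMDiff I' 𝓘(ℝ, Fin (Module.finrank ℝ E) → ℝ) ∞ (L ∘ u ∘ F) := by
      rw [contMDiff_pi_space]
      intro i
      have hi : ContMDiff 𝓘(ℝ, E) 𝓘(ℝ, ℝ) ∞ fun p => L (u p) i :=
        ((ContinuousLinearMap.proj (R := ℝ) i).comp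
          (L : E →L[ℝ] (Fin (Module.finrank ℝ E) → ℝ))).contDiff.contMDiff.comp hu
      exact Complex.reCLM.contDiff.contMDiff.comp (hF (SmoothFun.ofReal _ hi))
    have := L.symm.contDiff.contMDiff.comp hL
    convert this using 1
    ext y
    simp
  refine huF.contMDiffAt.congr_of_eventuallyEq ?_
  filter_upwards [hc.continuousAt.eventually b.eventuallyEq_one] with y hy
  simp [u, hy]

end SmoothFunctions

/-! ### Smoothness and discrete factors. -/

section DiscreteGroups

open Topology

variable {E H E' H' : Type*} [NormedAddCommGroup E] [NormedSpace ℝ E] [TopologicalSpace H]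
  {I : ModelWithCorners ℝ E H} [NormedAddCommGroup E'] [NormedSpace ℝ E'] [TopologicalSpace H']
  {I' : ModelWithCorners ℝ E' H'} {M N G : Type*} [TopologicalSpace M] [ChartedSpace H M]
  [TopologicalSpace N] [ChartedSpace H' N] [TopologicalSpace G] [DiscreteTopology G]

/-- Points of `M × G` close to each other have the same second component. -/
theorem contMDiff_prod_discrete_iff {f : M × G → N} :
    ContMDiff (I.prod (𝓡 0)) I' ∞ f ↔ ∀ g, ContMDiff I I' ∞ fun x => f (x, g) := by
  refine ⟨fun hf g => hf.comp (contMDiff_id.prodMk contMDiff_const), fun hf x => ?_⟩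
  refine ((hf x.2).comp contMDiff_fst x).congr_of_eventuallyEq ?_
  have : ∀ᶠ y : M × G in 𝓝 x, y.2 = x.2 :=
    continuous_snd.continuousAt.eventually (by simp : ∀ᶠ g in 𝓝 x.2, g = x.2)
  filter_upwards [this] with y hy
  simp [← hy]

theorem Continuous.contMDiff_discrete {θ : M → G} (hθ : Continuous θ) :
    ContMDiff I (𝓡 0) ∞ θ := by
  intro x
  refine contMDiffAt_const (c := θ x) |>.congr_of_eventuallyEq ?_
  exact hθ.continuousAt.eventually (by simp : ∀ᶠ g in 𝓝 (θ x), g = θ x)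

theorem ContMDiff.apply_discrete {f : M → G → N} (hf : ∀ g, ContMDiff I I' ∞ fun x => f x g)
    {θ : M → G} (hθ : Continuous θ) : ContMDiff I I' ∞ fun x => f x (θ x) :=
  (contMDiff_prod_discrete_iff (f := fun x : M × G => f x.1 x.2).2 hf).comp
    (contMDiff_id.prodMk hθ.contMDiff_discrete)

end DiscreteGroups

/-! ### Manifold structure induced by an open embedding. -/

section OpenEmbeddings

open Topology

variable {E : Type*} [NormedAddCommGroup E] {P Q : Type*} [TopologicalSpace P]
  [ChartedSpace E P] [TopologicalSpace Q]

/-- The chart of `Q` at `q` induced by an open embedding into a manifold. -/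
noncomputable def Topology.IsOpenEmbedding.inducedChart {e : Q → P} (he : IsOpenEmbedding e)
    (q : Q) : OpenPartialHomeomorph Q E :=
  haveI : Nonempty Q := ⟨q⟩
  (he.toOpenPartialHomeomorph e).trans (chartAt E (e q))

theorem Topology.IsOpenEmbedding.inducedChart_apply {e : Q → P} (he : IsOpenEmbedding e)
    (q x : Q) : he.inducedChart (E := E) q x = chartAt E (e q) (e x) := rfl

theorem Topology.IsOpenEmbedding.mem_inducedChart_source {e : Q → P} (he : IsOpenEmbedding e)
    {q x : Q} : x ∈ (he.inducedChart (E := E) q).source ↔ e x ∈ (chartAt E (e q)).source := by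
  simp [inducedChart]

/-- Makes the transition maps between induced charts restrictions of transition maps of `P`. -/
theorem Topology.IsOpenEmbedding.mem_inducedChart_target {e : Q → P} (he : IsOpenEmbedding e)
    {q : Q} {y : E} (hy : y ∈ (he.inducedChart (E := E) q).target) :
    y ∈ (chartAt E (e q)).target ∧
      e ((he.inducedChart (E := E) q).symm y) = (chartAt E (e q)).symm y := by
  have h1 := (he.inducedChart (E := E) q).map_target hy
  have h2 := (he.inducedChart (E := E) q).right_inv hy
  rw [mem_inducedChart_source] at h1
  rw [inducedChart_apply] at h2
  rw [← h2, (chartAt E (e q)).left_inv h1, h2]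
  exact ⟨h2 ▸ (chartAt E (e q)).map_source h1, rfl⟩

/-- The charted space structure induced by an open embedding into a charted space. -/
noncomputable abbrev Topology.IsOpenEmbedding.inducedChartedSpace {e : Q → P}
    (he : IsOpenEmbedding e) : ChartedSpace E Q where
  atlas := Set.range he.inducedChart
  chartAt := he.inducedChart
  mem_chart_source q := he.mem_inducedChart_source.2 (mem_chart_source E (e q))
  chart_mem_atlas q := ⟨q, rfl⟩

/-- An open subspace of a manifold is a manifold, whose inclusion is smooth and detects
smoothness. -/
theorem Topology.IsOpenEmbedding.exists_isManifold [NormedSpace ℝ E] [IsManifold 𝓘(ℝ, E) ∞ P] {e : Q → P}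
    (he : IsOpenEmbedding e) :
    ∃ _ : ChartedSpace E Q, IsManifold 𝓘(ℝ, E) ∞ Q ∧ ContMDiff 𝓘(ℝ, E) 𝓘(ℝ, E) ∞ e ∧
      ∀ f : P → Q, ContMDiff 𝓘(ℝ, E) 𝓘(ℝ, E) ∞ (e ∘ f) → ContMDiff 𝓘(ℝ, E) 𝓘(ℝ, E) ∞ f := by
  let := he.inducedChartedSpace (E := E)
  have hM : IsManifold 𝓘(ℝ, E) ∞ Q := by
    apply isManifold_of_contDiffOn
    rintro _ _ ⟨q, rfl⟩ ⟨q', rfl⟩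
    have h := (contDiffGroupoid ∞ 𝓘(ℝ, E)).compatible (chart_mem_atlas E (e q))
      (chart_mem_atlas E (e q'))
    rw [contDiffGroupoid, mem_groupoid_of_pregroupoid] at h
    have h1 := h.1
    simp only [contDiffPregroupoid, modelWithCornersSelf_coe, modelWithCornersSelf_coe_symm,
      Function.comp_id, Function.id_comp, Set.preimage_id, Set.range_id, Set.inter_univ,
      OpenPartialHomeomorph.trans_source, OpenPartialHomeomorph.symm_source,
      OpenPartialHomeomorph.coe_trans] at h1 ⊢
    have key : ∀ y ∈ (he.inducedChart (E := E) q).target ∩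
        (he.inducedChart q).symm ⁻¹' (he.inducedChart (E := E) q').source,
        y ∈ (chartAt E (e q)).target ∩ (chartAt E (e q)).symm ⁻¹' (chartAt E (e q')).source ∧
        he.inducedChart (E := E) q' ((he.inducedChart (E := E) q).symm y) =
          chartAt E (e q') ((chartAt E (e q)).symm y) := by
      intro y hy
      obtain ⟨ht, hs⟩ := he.mem_inducedChart_target hy.1
      have h2 := he.mem_inducedChart_source.1 hy.2
      rw [he.inducedChart_apply]
      rw [hs] at h2 ⊢
      exact ⟨⟨ht, h2⟩, rfl⟩
    exact (h1.mono fun y hy => (key y hy).1).congr fun y hy => (key y hy).2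
  refine ⟨inferInstance, hM, fun q => ?_, fun f hf => ?_⟩
  · have h1 : ContMDiffAt 𝓘(ℝ, E) 𝓘(ℝ, E) ∞ (chartAt E q) q :=
      contMDiffAt_of_mem_maximalAtlas (IsManifold.chart_mem_maximalAtlas q) (mem_chart_source E q)
    have h2 : ContMDiffAt 𝓘(ℝ, E) 𝓘(ℝ, E) ∞ (chartAt E (e q)).symm (chartAt E q q) :=
      contMDiffAt_symm_of_mem_maximalAtlas (IsManifold.chart_mem_maximalAtlas (e q))
        (mem_chart_target E (e q))
    refine (h2.comp q h1).congr_of_eventuallyEq ?_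
    filter_upwards [(chartAt E q).open_source.mem_nhds (mem_chart_source E q)] with x hx
    exact ((chartAt E (e q)).left_inv (he.mem_inducedChart_source.1 hx)).symm
  · have hc : Continuous f := he.isInducing.continuous_iff.2 hf.continuous
    intro p
    rw [contMDiffAt_iff_target]
    refine ⟨hc.continuousAt, ?_⟩
    have h1 : ContMDiffAt 𝓘(ℝ, E) 𝓘(ℝ, E) ∞ (chartAt E (e (f p))) (e (f p)) :=
      contMDiffAt_of_mem_maximalAtlas (IsManifold.chart_mem_maximalAtlas (e (f p)))
        (mem_chart_source E (e (f p)))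
    -- The induced chart at `f p` is the chart of `P` at `e (f p)` composed with `e`, so `f` and `e
    -- ∘ f` have the same expression in charts.
    exact ContMDiffAt.comp (f := e ∘ f) p h1 (hf p)

end OpenEmbeddings

/-! ### Trivializations and local sections. -/

section Trivialization

open Topology

variable {E F : Type*} [NormedAddCommGroup E] [NormedSpace ℝ E]
  [NormedAddCommGroup F] [NormedSpace ℝ F]
  {P M G : Type*} [TopologicalSpace P] [ChartedSpace E P] [TopologicalSpace M] [ChartedSpace F M]
  [Group G] [TopologicalSpace G] [DiscreteTopology G]

/-- A smooth action with an equivariant continuous map to the group and a smooth section on which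
this map is trivial is a trivial principal bundle. -/
theorem isTrivialPrincipalBundle_of_section {q : P → M} {σ : P → G → P} {θ : P → G} {s : M → P}
    (hq : ContMDiff 𝓘(ℝ, E) 𝓘(ℝ, F) ∞ q)
    (hσ : ∀ g, ContMDiff 𝓘(ℝ, E) 𝓘(ℝ, E) ∞ fun p => σ p g) (h1 : ∀ p, σ p 1 = p)
    (hmul : ∀ p g h, σ p (g * h) = σ (σ p g) h) (hqσ : ∀ p g, q (σ p g) = q p)
    (hθ : Continuous θ) (hθσ : ∀ p g, θ (σ p g) = θ p * g)
    (hs : ContMDiff 𝓘(ℝ, F) 𝓘(ℝ, E) ∞ s) (hqs : ∀ x, q (s x) = x) (hθs : ∀ x, θ (s x) = 1)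
    (hsq : ∀ p, σ (s (q p)) (θ p) = p) :
    IsTrivialPrincipalBundle E F q σ := by
  let φ : Diffeomorph 𝓘(ℝ, E) (𝓘(ℝ, F).prod (𝓡 0)) P (M × G) ∞ :=
    { toFun := fun p => (q p, θ p)
      invFun := fun x => σ (s x.1) x.2
      left_inv := hsq
      right_inv := fun x => by simp [hqσ, hqs, hθσ, hθs]
      contMDiff_toFun := hq.prodMk hθ.contMDiff_discrete
      contMDiff_invFun := contMDiff_prod_discrete_iff.2 fun g => (hσ g).comp hs }
  have hφ : ∀ p g, φ (σ p g) = ((φ p).1, (φ p).2 * g) := fun p g =>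
    Prod.ext (hqσ p g) (hθσ p g)
  exact
    { smooth_proj := hq
      smooth_act := contMDiff_prod_discrete_iff.2 hσ
      act_one := h1
      act_mul := hmul
      proj_act := hqσ
      locally_trivial := fun x => ⟨Set.univ, isOpen_univ, trivial, φ.toPartialDiffeomorph,
        rfl, Set.univ_prod_univ.symm, fun _ _ => rfl, fun p _ g => hφ p g⟩
      trivial := ⟨φ, fun _ => rfl, hφ⟩ }

/-- A principal bundle over the orbit space has smooth local sections. -/
theorem IsPrincipalBundle.exists_local_section {q : P → M} {σ : P → G → P}
    (h : IsPrincipalBundle E F q σ) (x : M) :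
    ∃ t : M → P, ContMDiffAt 𝓘(ℝ, F) 𝓘(ℝ, E) ∞ t x ∧ ∀ᶠ y in 𝓝 x, q (t y) = y := by
  obtain ⟨U, hU, hx, ψ, hsrc, htgt, hψ, -⟩ := h.locally_trivial x
  have hmem : ∀ y ∈ U, (y, (1 : G)) ∈ ψ.target := fun y hy => htgt ▸ ⟨hy, trivial⟩
  refine ⟨fun y => ψ.symm (y, 1), ?_, ?_⟩
  · have h2 : ContMDiffAt (𝓘(ℝ, F).prod (𝓡 0)) 𝓘(ℝ, E) ∞ ψ.symm (x, (1 : G)) :=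
      ψ.contMDiffOn_invFun.contMDiffAt (ψ.open_target.mem_nhds (hmem x hx))
    exact h2.comp x (contMDiffAt_id.prodMk contMDiffAt_const)
  · filter_upwards [hU.mem_nhds hx] with y hy
    have h3 : ψ.symm (y, 1) ∈ q ⁻¹' U := hsrc ▸ ψ.map_target (hmem y hy)
    rw [← hψ _ h3]
    exact congrArg Prod.fst (ψ.right_inv (hmem y hy))

end Trivialization

/-! ### The action on points induced by a dynamical system. -/

section InducedActions

open Topology

variable {E : Type*} [NormedAddCommGroup E] [NormedSpace ℝ E]
  {P : Type*} [TopologicalSpace P] [ChartedSpace E P]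
  {G : Type*} [Group G] [TopologicalSpace G]

theorem DynamicalSystem.induces_iff {α : DynamicalSystem (SmoothFun E P) G} {σ : P → G → P} :
    α.Induces σ ↔ ∀ p g f, f (σ p g) = α.toHom g f p :=
  forall₂_congr fun _ _ => DFunLike.ext_iff

variable [FiniteDimensional ℝ E] [T2Space P] [IsManifold 𝓘(ℝ, E) ∞ P]

theorem DynamicalSystem.existsUnique_induces [SecondCountableTopology P]
    (α : DynamicalSystem (SmoothFun E P) G) : ∃! σ : P → G → P, α.Induces σ := by
  choose σ hσ using fun p g =>
    SmoothFun.exists_eq_eval ((SmoothFun.eval (E := E) (p : P)).comp (α.toHom g).toAlgHom)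
  refine ⟨σ, fun p g => (hσ p g).symm, fun σ' h => ?_⟩
  ext p g
  exact SmoothFun.eval_injective ((h p g).trans (hσ p g))

/-- Composing `f` with the action of `g` gives `α.toHom g f`, which is smooth for every smooth `f`.
-/
theorem DynamicalSystem.Induces.contMDiff {α : DynamicalSystem (SmoothFun E P) G} {σ : P → G → P}
    (h : α.Induces σ) (g : G) : ContMDiff 𝓘(ℝ, E) 𝓘(ℝ, E) ∞ fun p => σ p g :=
  contMDiff_of_forall_smoothFun fun f =>
    (α.toHom g f).contMDiff.congr fun p => induces_iff.1 h p g f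

theorem DynamicalSystem.Induces.act_one {α : DynamicalSystem (SmoothFun E P) G} {σ : P → G → P}
    (h : α.Induces σ) (p : P) : σ p 1 = p :=
  SmoothFun.eval_injective (E := E) <| AlgHom.ext fun f => by
    simp only [SmoothFun.eval_apply, induces_iff.1 h, map_one, AlgEquiv.one_apply]

/-- Passing from functions to points reverses the order, so the left action `α` becomes a right
action. -/
theorem DynamicalSystem.Induces.act_mul {α : DynamicalSystem (SmoothFun E P) G} {σ : P → G → P}
    (h : α.Induces σ) (p : P) (g k : G) : σ p (g * k) = σ (σ p g) k :=
  SmoothFun.eval_injective (E := E) <| AlgHom.ext fun f => by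
    simp only [SmoothFun.eval_apply, induces_iff.1 h, map_mul, AlgEquiv.mul_apply]

end InducedActions

/-! ### The orbit space of a trivial noncommutative principal bundle. -/

section Trivialization

open Topology

/-- The action induced by a trivial noncommutative principal bundle has an equivariant continuous
map to the group. -/
theorem DynamicalSystem.IsTrivialNCPBundle.exists_equivariant {E : Type*} [NormedAddCommGroup E]
    [NormedSpace ℝ E] {P : Type*} [TopologicalSpace P] [ChartedSpace E P] {G : Type*} [CommGroup G]
    [Finite G] [TopologicalSpace G] [DiscreteTopology G] {α : DynamicalSystem (SmoothFun E P) G}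
    (hα : α.IsTrivialNCPBundle) {σ : P → G → P} (hσ : α.Induces σ) :
    ∃ θ : P → G, Continuous θ ∧ ∀ p g, θ (σ p g) = θ p * g := by
  obtain ⟨S, hS, -, H⟩ := hα
  have H' : ∀ s : G, ∃ (χ : G →* Circle) (a : SmoothFun E P), s ∈ S →
      IsDualCharacter S s χ ∧ a ∈ α.isotypic χ ∧ a ^ orderOf s = 1 := fun s => by
    by_cases hs : s ∈ S
    · obtain ⟨χ, hχ, a, ha, -, hn⟩ := H s hs
      exact ⟨χ, a, fun _ => ⟨hχ, ha, hn⟩⟩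
    · exact ⟨1, 1, fun h => absurd h hs⟩
  choose χ a h using H'
  have hpow : ∀ p, ∀ s ∈ S, (a s p) ^ orderOf s = 1 := fun p s hs => by
    rw [← SmoothFun.eval_apply, ← map_pow, (h s hs).2.2, map_one]
  -- `θ p` is the element at which each `χ s` takes the value `a s p`.
  choose θ hθ using fun p => exists_dualCharacters_eq (fun s hs => (h s hs).1) (hpow p)
  have hinj : ∀ g k : G, (∀ s ∈ S, (χ s g : ℂ) = χ s k) → g = k := fun g k hgk =>
    eq_of_dualCharacters_eq hS (fun s hs => (h s hs).1) fun s hs => Circle.ext (hgk s hs)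
  refine ⟨θ, ?_, fun p g => hinj _ _ fun s hs => ?_⟩
  -- The dual characters embed the finite discrete group in a power of `ℂ`, where the components of
  -- `θ` become the continuous functions `a s`.
  · have hemb : IsEmbedding fun (g : G) (s : S) => (χ s g : ℂ) := by
      refine (Topology.IsClosedEmbedding.of_continuous_injective_isClosedMap
        continuous_of_discreteTopology (fun g k hgk => hinj g k fun s hs => congrFun hgk ⟨s, hs⟩)
        fun A _ => (Set.toFinite _).isClosed).isEmbedding
    rw [hemb.continuous_iff]
    refine continuous_pi fun s => ?_
    exact (a s).contMDiff.continuous.congr fun p => (hθ p s s.2).symm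
  · rw [hθ _ s hs, map_mul, Circle.coe_mul, hθ _ s hs, induces_iff.1 hσ, (h s hs).2.1 g,
      SmoothFun.smul_apply, mul_comm]

variable {P G : Type*} [Group G]

/-- The section of the orbit map on which an equivariant map to the group is trivial. -/
def OrbitSpace.unitSection {σ : P → G → P} {θ : P → G}
    (hmul : ∀ p g h, σ p (g * h) = σ (σ p g) h) (hθσ : ∀ p g, θ (σ p g) = θ p * g) :
    OrbitSpace σ → P :=
  Quot.lift (fun p => σ p (θ p)⁻¹) fun p p' ⟨g, hg⟩ => by
    rw [← hg, hθσ, ← hmul, mul_inv_rev, mul_inv_cancel_left]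

section

variable {σ : P → G → P} {θ : P → G} (hmul : ∀ p g h, σ p (g * h) = σ (σ p g) h)
  (hθσ : ∀ p g, θ (σ p g) = θ p * g)

theorem OrbitSpace.mk_unitSection (x : OrbitSpace σ) :
    (Quot.mk _ (OrbitSpace.unitSection hmul hθσ x) : OrbitSpace σ) = x := by
  obtain ⟨p, rfl⟩ := Quot.exists_rep x
  exact (Quot.sound ⟨(θ p)⁻¹, rfl⟩).symm

theorem OrbitSpace.apply_unitSection (x : OrbitSpace σ) :
    θ (OrbitSpace.unitSection hmul hθσ x) = 1 := by
  obtain ⟨p, rfl⟩ := Quot.exists_rep x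
  exact (hθσ p _).trans (mul_inv_cancel _)

theorem OrbitSpace.unitSection_mk_act (h1 : ∀ p, σ p 1 = p) (p : P) :
    σ (OrbitSpace.unitSection hmul hθσ (Quot.mk _ p)) (θ p) = p := by
  change σ (σ p (θ p)⁻¹) (θ p) = p
  rw [← hmul, inv_mul_cancel, h1]

/-- The orbit map is a left inverse of the section, and the image of an open `U` is the part of its
preimage in `P` on which `θ = 1`. That part is open because `{1}` is open in the discrete group. -/
theorem OrbitSpace.isOpenEmbedding_unitSection [TopologicalSpace P]
    [TopologicalSpace G] [DiscreteTopology G] (h1 : ∀ p, σ p 1 = p)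
    (hθ : Continuous θ) (hσ : Continuous fun p => σ p (θ p)⁻¹) :
    IsOpenEmbedding (OrbitSpace.unitSection hmul hθσ) := by
  refine .of_continuous_injective_isOpenMap (continuous_quot_lift _ hσ)
    (Function.LeftInverse.injective (OrbitSpace.mk_unitSection hmul hθσ)) fun U hU => ?_
  have himg : OrbitSpace.unitSection hmul hθσ '' U = Quot.mk _ ⁻¹' U ∩ θ ⁻¹' {1} := by
    ext p
    constructor
    · rintro ⟨x, hx, rfl⟩
      exact ⟨by rwa [Set.mem_preimage, OrbitSpace.mk_unitSection],
        OrbitSpace.apply_unitSection hmul hθσ x⟩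
    · rintro ⟨hp, hp1⟩
      refine ⟨_, hp, ?_⟩
      have := OrbitSpace.unitSection_mk_act hmul hθσ h1 p
      rwa [show θ p = 1 from hp1, h1] at this
  rw [himg]
  exact (hU.preimage continuous_quot_mk).inter ((isOpen_discrete _).preimage hθ)

end

/-- The orbit space of the action induced by a trivial noncommutative principal bundle. -/
theorem DynamicalSystem.IsTrivialNCPBundle.orbitSpace {E : Type*} [NormedAddCommGroup E]
    [NormedSpace ℝ E] [FiniteDimensional ℝ E] {P : Type*} [TopologicalSpace P] [T2Space P]
    [SecondCountableTopology P] [ChartedSpace E P] [IsManifold 𝓘(ℝ, E) ∞ P] {G : Type*}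
    [CommGroup G] [Finite G] [TopologicalSpace G] [DiscreteTopology G]
    {α : DynamicalSystem (SmoothFun E P) G} (hα : α.IsTrivialNCPBundle) {σ : P → G → P}
    (h : α.Induces σ) :
    T2Space (OrbitSpace σ) ∧ SecondCountableTopology (OrbitSpace σ) ∧
    (∃ _ : ChartedSpace E (OrbitSpace σ), IsManifold 𝓘(ℝ, E) ∞ (OrbitSpace σ) ∧
      IsPrincipalBundle E E (Quot.mk _ : P → OrbitSpace σ) σ) ∧
    ∀ [ChartedSpace E (OrbitSpace σ)] [IsManifold 𝓘(ℝ, E) ∞ (OrbitSpace σ)],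
      IsPrincipalBundle E E (Quot.mk _ : P → OrbitSpace σ) σ →
      IsTrivialPrincipalBundle E E (Quot.mk _ : P → OrbitSpace σ) σ := by
  obtain ⟨θ, hθ, hθσ⟩ := hα.exists_equivariant h
  -- This map is the retraction of `P` onto `θ ⁻¹' {1}` along the orbits; it is smooth because `θ`
  -- is locally constant.
  have hproj : ContMDiff 𝓘(ℝ, E) 𝓘(ℝ, E) ∞ fun p => σ p (θ p)⁻¹ :=
    ContMDiff.apply_discrete h.contMDiff hθ.inv
  have he := OrbitSpace.isOpenEmbedding_unitSection h.act_mul hθσ h.act_one hθ hproj.continuous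
  have hqσ : ∀ p g, (Quot.mk _ (σ p g) : OrbitSpace σ) = Quot.mk _ p :=
    fun p g => (Quot.sound ⟨g, rfl⟩).symm
  have htriv : ∀ [ChartedSpace E (OrbitSpace σ)],
      ContMDiff 𝓘(ℝ, E) 𝓘(ℝ, E) ∞ (Quot.mk _ : P → OrbitSpace σ) →
      ContMDiff 𝓘(ℝ, E) 𝓘(ℝ, E) ∞ (OrbitSpace.unitSection h.act_mul hθσ) →
      IsTrivialPrincipalBundle E E (Quot.mk _ : P → OrbitSpace σ) σ := fun hq hs =>
    isTrivialPrincipalBundle_of_section hq h.contMDiff h.act_one h.act_mul hqσ hθ hθσ hs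
      (OrbitSpace.mk_unitSection h.act_mul hθσ) (OrbitSpace.apply_unitSection h.act_mul hθσ)
      (OrbitSpace.unitSection_mk_act h.act_mul hθσ h.act_one)
  refine ⟨he.isEmbedding.t2Space, he.isEmbedding.secondCountableTopology, ?_, ?_⟩
  · obtain ⟨hch, hM, hs, hsmooth⟩ := he.exists_isManifold (E := E)
    exact ⟨hch, hM, (htriv (hsmooth _ hproj) hs).toIsPrincipalBundle⟩
  · intro hch hM hb
    -- For an arbitrary bundle structure only the smoothness of the section is in question. Near `x`
    -- the section is a smooth local section `t` followed by the retraction.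
    refine htriv hb.smooth_proj fun x => ?_
    obtain ⟨t, ht, hqt⟩ := hb.exists_local_section x
    refine (hproj.contMDiffAt.comp x ht).congr_of_eventuallyEq ?_
    filter_upwards [hqt] with y hy
    conv_lhs => rw [← hy]
    rfl

end Trivialization

/-! ### From trivial principal bundles to dynamical systems. -/

section Pullback

variable {E : Type*} [NormedAddCommGroup E] [NormedSpace ℝ E]
  {P : Type*} [TopologicalSpace P] [ChartedSpace E P]

/-- The algebra automorphism of `C^∞(P)` given by pullback along a diffeomorphism of `P`. -/
noncomputable def Diffeomorph.smoothFunAlgEquiv (τ : Diffeomorph 𝓘(ℝ, E) 𝓘(ℝ, E) P P ∞) :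
    SmoothFun E P ≃ₐ[ℂ] SmoothFun E P where
  toFun f := ⟨fun p => f (τ p), f.contMDiff.comp τ.contMDiff⟩
  invFun f := ⟨fun p => f (τ.symm p), f.contMDiff.comp τ.symm.contMDiff⟩
  left_inv f := by ext p; exact congrArg f (τ.apply_symm_apply p)
  right_inv f := by ext p; exact congrArg f (τ.symm_apply_apply p)
  map_mul' _ _ := rfl
  map_add' _ _ := rfl
  commutes' _ := rfl

theorem Diffeomorph.trans_mem_maximalAtlas [IsManifold 𝓘(ℝ, E) ∞ P]
    (τ : Diffeomorph 𝓘(ℝ, E) 𝓘(ℝ, E) P P ∞) {φ : OpenPartialHomeomorph P E}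
    (hφ : φ ∈ IsManifold.maximalAtlas 𝓘(ℝ, E) ∞ P) :
    τ.toHomeomorph.toOpenPartialHomeomorph.trans φ ∈ IsManifold.maximalAtlas 𝓘(ℝ, E) ∞ P := by
  rw [IsManifold.mem_maximalAtlas_iff_contMDiffOn] at hφ ⊢
  refine ⟨hφ.1.comp τ.contMDiff.contMDiffOn fun p hp => ?_,
    τ.symm.contMDiff.comp_contMDiffOn (hφ.2.mono fun y hy => ?_)⟩
  · simpa using hp
  · simpa using hy

/-- Pullback along a diffeomorphism is continuous for the smooth compact open topology. -/
theorem Diffeomorph.continuous_smoothFunAlgEquiv [IsManifold 𝓘(ℝ, E) ∞ P]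
    (τ : Diffeomorph 𝓘(ℝ, E) 𝓘(ℝ, E) P P ∞) : Continuous τ.smoothFunAlgEquiv := by
  refine continuous_iInf_rng.2 fun φ => continuous_iInf_rng.2 fun hφ =>
    continuous_iInf_rng.2 fun k => continuous_induced_rng.2 ?_
  -- In the chart `φ` the function `f ∘ τ` has the same expression as `f` in the chart `φ ∘ τ⁻¹`,
  -- which has the same target. As the topology ranges over the maximal atlas, each condition on `f
  -- ∘ τ` is thus one of the defining conditions on `f`, and no chain rule enters.
  have hψ := τ.symm.trans_mem_maximalAtlas hφ
  have hK : {K : Set E | IsCompact K ∧ K ⊆ φ.target} = {K : Set E | IsCompact K ∧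
      K ⊆ (τ.symm.toHomeomorph.toOpenPartialHomeomorph.trans φ).target} := by
    simp
  rw [hK]
  exact continuous_iInf_dom (i := τ.symm.toHomeomorph.toOpenPartialHomeomorph.trans φ) <|
    continuous_iInf_dom (i := hψ) <| continuous_iInf_dom (i := k) continuous_induced_dom

variable {G : Type*} [Group G] [TopologicalSpace G] [DiscreteTopology G]

theorem IsPrincipalBundle.contMDiff_act {F : Type*} [NormedAddCommGroup F] [NormedSpace ℝ F]
    {M : Type*} [TopologicalSpace M] [ChartedSpace F M] {q : P → M} {σ : P → G → P}
    (h : IsPrincipalBundle E F q σ) (g : G) : ContMDiff 𝓘(ℝ, E) 𝓘(ℝ, E) ∞ fun p => σ p g :=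
  contMDiff_prod_discrete_iff.1 h.smooth_act g

/-- The diffeomorphism of the total space of a principal bundle given by a group element. -/
def IsPrincipalBundle.diffeomorph {F : Type*} [NormedAddCommGroup F] [NormedSpace ℝ F]
    {M : Type*} [TopologicalSpace M] [ChartedSpace F M] {q : P → M} {σ : P → G → P}
    (h : IsPrincipalBundle E F q σ) (g : G) : Diffeomorph 𝓘(ℝ, E) 𝓘(ℝ, E) P P ∞ where
  toFun p := σ p g
  invFun p := σ p g⁻¹
  left_inv p := by dsimp only; rw [← h.act_mul, mul_inv_cancel, h.act_one]
  right_inv p := by dsimp only; rw [← h.act_mul, inv_mul_cancel, h.act_one]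
  contMDiff_toFun := h.contMDiff_act g
  contMDiff_invFun := h.contMDiff_act g⁻¹

/-- The dynamical system on the smooth functions on the total space of a principal bundle. -/
noncomputable def IsPrincipalBundle.dynamicalSystem [IsManifold 𝓘(ℝ, E) ∞ P] {F : Type*}
    [NormedAddCommGroup F] [NormedSpace ℝ F] {M : Type*} [TopologicalSpace M] [ChartedSpace F M]
    {q : P → M} {σ : P → G → P} (h : IsPrincipalBundle E F q σ) :
    DynamicalSystem (SmoothFun E P) G where
  toHom :=
    { toFun := fun g => (h.diffeomorph g).smoothFunAlgEquiv
      map_one' := by ext f p; exact congrArg f (h.act_one p)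
      map_mul' := fun g k => by ext f p; exact congrArg f (h.act_mul p g k) }
  continuous_action := continuous_prod_of_discrete_left.2 fun g =>
    (h.diffeomorph g).continuous_smoothFunAlgEquiv

theorem IsPrincipalBundle.dynamicalSystem_apply [IsManifold 𝓘(ℝ, E) ∞ P] {F : Type*}
    [NormedAddCommGroup F] [NormedSpace ℝ F] {M : Type*} [TopologicalSpace M] [ChartedSpace F M]
    {q : P → M} {σ : P → G → P} (h : IsPrincipalBundle E F q σ) (g : G) (f : SmoothFun E P)
    (p : P) : h.dynamicalSystem.toHom g f p = f (σ p g) := rfl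

theorem IsTrivialPrincipalBundle.isTrivialNCPBundle [IsManifold 𝓘(ℝ, E) ∞ P] {F : Type*}
    [NormedAddCommGroup F] [NormedSpace ℝ F] {M : Type*} [TopologicalSpace M] [ChartedSpace F M]
    {G : Type*} [CommGroup G] [Finite G] [TopologicalSpace G] [DiscreteTopology G]
    {q : P → M} {σ : P → G → P} (h : IsTrivialPrincipalBundle E F q σ) :
    h.toIsPrincipalBundle.dynamicalSystem.IsTrivialNCPBundle := by
  obtain ⟨φ, -, hφ⟩ := h.trivial
  obtain ⟨S, hS, hcard, H⟩ := exists_generators_dualCharacter G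
  refine ⟨S, hS, hcard, fun s hs => ?_⟩
  obtain ⟨χ, hχ⟩ := H s hs
  have hθ : Continuous fun p => (φ p).2 := continuous_snd.comp φ.continuous
  let a : SmoothFun E P := ⟨fun p => (χ (φ p).2 : ℂ), ContMDiff.apply_discrete
    (f := fun (_ : P) g => (χ g : ℂ)) (fun _ => contMDiff_const) hθ⟩
  have ha : a ^ orderOf s = 1 := by
    ext p
    rw [← SmoothFun.eval_apply, map_pow]
    change (χ (φ p).2 : ℂ) ^ orderOf s = 1
    -- Since `S` generates, `χ` takes only powers of `χ s` as values, and these are roots of unity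
    -- of order dividing `orderOf s`.
    obtain ⟨m, hm⟩ := hχ.exists_apply_eq_pow hS hs (φ p).2
    rw [hm, Circle.coe_pow, ← pow_mul, mul_comm, pow_mul, hχ.isPrimitiveRoot.pow_eq_one, one_pow]
  refine ⟨χ, hχ, a, fun g => ?_, ?_, ha⟩
  · ext p
    rw [IsPrincipalBundle.dynamicalSystem_apply, SmoothFun.smul_apply]
    change (χ (φ (σ p g)).2 : ℂ) = χ g * χ (φ p).2
    rw [hφ, map_mul, Circle.coe_mul, mul_comm]
  · exact SmoothFun.isUnit_of_forall_ne_zero fun p => Circle.coe_ne_zero _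

end Pullback

theorem mainTheorem5
    {E : Type*} [NormedAddCommGroup E] [NormedSpace ℝ E] [FiniteDimensional ℝ E]
    {P : Type*} [TopologicalSpace P] [T2Space P] [SecondCountableTopology P]
    [ChartedSpace E P] [IsManifold 𝓘(ℝ, E) ∞ P]
    {Λ : Type*} [CommGroup Λ] [Finite Λ] [TopologicalSpace Λ] [DiscreteTopology Λ] :
    (∀ α : DynamicalSystem (SmoothFun E P) Λ, α.IsTrivialNCPBundle →
      (∃! σ : P → Λ → P, α.Induces σ) ∧
      ∀ σ : P → Λ → P, α.Induces σ →
        T2Space (OrbitSpace σ) ∧ SecondCountableTopology (OrbitSpace σ) ∧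
        (∃ _ : ChartedSpace E (OrbitSpace σ), IsManifold 𝓘(ℝ, E) ∞ (OrbitSpace σ) ∧
          IsPrincipalBundle E E (Quot.mk _ : P → OrbitSpace σ) σ) ∧
        ∀ [ChartedSpace E (OrbitSpace σ)] [IsManifold 𝓘(ℝ, E) ∞ (OrbitSpace σ)],
          IsPrincipalBundle E E (Quot.mk _ : P → OrbitSpace σ) σ →
          IsTrivialPrincipalBundle E E (Quot.mk _ : P → OrbitSpace σ) σ) ∧
    (∀ {F : Type*} [NormedAddCommGroup F] [NormedSpace ℝ F] [FiniteDimensional ℝ F]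
      {M : Type*} [TopologicalSpace M] [T2Space M] [SecondCountableTopology M]
      [ChartedSpace F M] [IsManifold 𝓘(ℝ, F) ∞ M] (q : P → M) (σ : P → Λ → P),
      IsTrivialPrincipalBundle E F q σ →
      ∃ α : DynamicalSystem (SmoothFun E P) Λ,
        (∀ (g : Λ) (f : SmoothFun E P) (p : P), α.toHom g f p = f (σ p g)) ∧
        α.IsTrivialNCPBundle) := by

  refine ⟨fun α hα => ⟨α.existsUnique_induces, fun σ hσ => hα.orbitSpace hσ⟩, ?_⟩
  intro F _ _ _ M _ _ _ _ _ q σ h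
  exact ⟨h.toIsPrincipalBundle.dynamicalSystem, fun _ _ _ => rfl, h.isTrivialNCPBundle⟩
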